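/- Let $R$ be an associative ring with unit and let $T$ be a $1$-tilting right $R$-module, that is: (T1) $\mathrm{p.d.}\,T\le 1$; (T2) $\mathrm{Ext}^i_R(T,T^{(\lambda)})=0$ for all $i\ge 1$ and all cardinals $\lambda$; (T3) there is an exact sequence $0\to R\to T_0\to T_1\to 0$ with $T_0,T_1\in\mathrm{Add}\,T$, where $\mathrm{Add}\,T$ is the class of direct summands of direct sums of copies of $T$. Assume moreover that there is an exact sequence $0\to R\to T\to T_1\to 0$ of right $R$-modules in which $T_1$ is a direct summand of $T$. Put $S=\mathrm{End}_R(T)$, so that $T$ is an $S$-$R$-bimodule, and let $\mathcal T=\mathrm{Gen}\,T$ be the torsion class associated with $T$, i.e. the full subcategory of $\mathrm{Mod}\text{-}R$ of the epimorphic images of direct sums of copies of $T$. Let $W$ be an injective cogenerator of $\mathrm{Mod}\text{-}R$ and let $T^d=\mathrm{Hom}_R(T,W)$, a right $S$-module. In $\mathrm{Mod}\text{-}S$ consider $$\mathcal F_{T^d}=\mathrm{Cogen}\,T^d=\{N\mid N \text{ embeds in a direct product of copies of } T^d\},$$ $$\mathcal E=\{N\mid N\otimes_S T=0=\mathrm{Tor}_1^S(N,T)\},\qquad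 \mathcal M=\{M\mid \mathrm{Hom}_S(N,M)=0=\mathrm{Ext}^1_S(N,M)\text{ for all }N\in\mathcal E\},$$ and let $\mathcal Y=\mathcal F_{T^d}\cap\mathcal M$, viewed as a full subcategory. Let $\Sigma$ be the class of morphisms $u$ of $\mathrm{Mod}\text{-}S$ such that $u\otimes_S T$ is invertible in $\mathrm{Mod}\text{-}R$. Then: (1) $\Sigma$ admits a calculus of left fractions (in the sense of Gabriel and Zisman). (2) There is an equivalence $\rho\colon \mathrm{Mod}\text{-}S[\Sigma^{-1}]\to\mathcal T$ such that $\rho\circ q=-\otimes_S T$, where $q\colon\mathrm{Mod}\text{-}S\to\mathrm{Mod}\text{-}S[\Sigma^{-1}]$ is the canonical localization functor. (3) There is an equivalence between $\mathrm{Mod}\text{-}S[\Sigma^{-1}]$ and the category $\mathcal Y$. -/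

import Mathlib

open CategoryTheory MulOpposite
open scoped TensorProduct

universe u

namespace Tilting

noncomputable section

/-! A right module over a ring `A` is a module over the opposite ring `Aᵐᵒᵖ`; the right action
`m · a` is written `op a • m`. -/

/-- The category `Mod-A` of right `A`-modules. -/
abbrev RightMod (A : Type u) [Ring A] := ModuleCat.{u} Aᵐᵒᵖ

/-- `M` is (isomorphic to) a direct summand of `N`. -/
def IsDirectSummand (A M N : Type u) [Ring A] [AddCommGroup M] [Module A M]
    [AddCommGroup N] [Module A N] : Prop :=
  ∃ (i : M →ₗ[A] N) (p : N →ₗ[A] M), p ∘ₗ i = LinearMap.id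

/-- `M` belongs to `Add T`: it is a direct summand of a direct sum of copies of `T`. -/
def InAdd (A T M : Type u) [Ring A] [AddCommGroup T] [Module A T]
    [AddCommGroup M] [Module A M] : Prop :=
  ∃ ι : Type u, IsDirectSummand A M (ι →₀ T)

/-- `0 → L → M → N → 0`, with maps `f` and `g`, is a short exact sequence. -/
def IsShortExact {A L M N : Type u} [Ring A] [AddCommGroup L] [Module A L]
    [AddCommGroup M] [Module A M] [AddCommGroup N] [Module A N]
    (f : L →ₗ[A] M) (g : M →ₗ[A] N) : Prop :=
  Function.Injective f ∧ Function.Exact f g ∧ Function.Surjective g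

/-- The class `Gen T` of the modules generated by `T`, that is, of the epimorphic images of direct
sums of copies of `T`. -/
def gen (A T : Type u) [Ring A] [AddCommGroup T] [Module A T] :
    ObjectProperty (ModuleCat.{u} A) :=
  fun M => ∃ (ι : Type u) (f : (ι →₀ T) →ₗ[A] M), Function.Surjective f

/-- The class `Cogen C` of the modules cogenerated by `C`, that is, of the modules which embed in
a direct product of copies of `C`. -/
def cogen (A C : Type u) [Ring A] [AddCommGroup C] [Module A C] :
    ObjectProperty (ModuleCat.{u} A) :=
  fun N => ∃ (ι : Type u) (f : N →ₗ[A] (ι → C)), Function.Injective f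

/-- The right perpendicular class of a class `P` of modules, formed with `Hom` and `Ext¹`. -/
def rightPerp {A : Type u} [Ring A] (P : ObjectProperty (ModuleCat.{u} A)) :
    ObjectProperty (ModuleCat.{u} A) :=
  fun M => ∀ N : ModuleCat.{u} A, P N →
    (∀ f : N ⟶ M, f = 0) ∧ Subsingleton (Abelian.Ext.{u} N M 1)

section Tilting

variable (R T : Type u) [Ring R] [AddCommGroup T] [Module Rᵐᵒᵖ T]

/-- The right `R`-module `T` is `1`-tilting. -/
structure IsOneTilting : Prop where
  projDim_le_one : HasProjectiveDimensionLE (ModuleCat.of Rᵐᵒᵖ T) 1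
  ext_eq_zero : ∀ (ι : Type u) (i : ℕ), 1 ≤ i →
    Subsingleton (Abelian.Ext.{u} (ModuleCat.of Rᵐᵒᵖ T) (ModuleCat.of Rᵐᵒᵖ (ι →₀ T)) i)
  exists_sequence : ∃ (T₀ T₁ : RightMod R) (f : R →ₗ[Rᵐᵒᵖ] T₀) (g : T₀ →ₗ[Rᵐᵒᵖ] T₁),
    InAdd Rᵐᵒᵖ T T₀ ∧ InAdd Rᵐᵒᵖ T T₁ ∧ IsShortExact f g

/-- There is a short exact sequence `0 → R → T → T₁ → 0` of right `R`-modules in which `T₁` is a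
direct summand of `T`. -/
def HasSpecialSequence : Prop :=
  ∃ (T₁ : RightMod R) (f : R →ₗ[Rᵐᵒᵖ] T) (g : T →ₗ[Rᵐᵒᵖ] T₁),
    IsDirectSummand Rᵐᵒᵖ T₁ T ∧ IsShortExact f g

/-- The endomorphism ring `S` of the right `R`-module `T`, with `(f * g) t = f (g t)`; it acts on
`T` from the left. -/
abbrev EndRing := Module.End Rᵐᵒᵖ T

end Tilting

section Tensor

/-! The tensor product `N ⊗_S T` of a right `S`-module `N` and an `S`-`R`-bimodule `T`, as a right
`R`-module. It is the quotient of the tensor product of the abelian groups `N` and `T` by the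
subgroup generated by the elements `(n · s) ⊗ t - n ⊗ (s · t)`. The tensor product over `ℤ` is
written `T ⊗[ℤ] N`, where `t ⊗ₜ n` stands for `n ⊗ t`, because Mathlib's scalar action on a tensor
product uses the left factor. -/

variable (S R T : Type u) [Ring S] [Ring R] [AddCommGroup T] [Module S T] [Module Rᵐᵒᵖ T]
  [SMulCommClass S Rᵐᵒᵖ T]

/-- The elements `(n · s) ⊗ t - n ⊗ (s · t)`. -/
def tensorRel (N : Type u) [AddCommGroup N] [Module Sᵐᵒᵖ N] : Set (T ⊗[ℤ] N) :=
  {x | ∃ (n : N) (s : S) (t : T), x = t ⊗ₜ[ℤ] (op s • n) - (s • t) ⊗ₜ[ℤ] n}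

/-- The additive subgroup generated by `tensorRel`, which is stable under `R`. -/
def tensorKer (N : Type u) [AddCommGroup N] [Module Sᵐᵒᵖ N] : Submodule Rᵐᵒᵖ (T ⊗[ℤ] N) where
  toAddSubmonoid := (AddSubgroup.closure (tensorRel S T N)).toAddSubmonoid
  smul_mem' := by
    intro r x hx
    change r • x ∈ AddSubgroup.closure (tensorRel S T N)
    replace hx : x ∈ AddSubgroup.closure (tensorRel S T N) := hx
    induction hx using AddSubgroup.closure_induction with
    | mem x hx =>
      obtain ⟨n, s, t, rfl⟩ := hx
      refine AddSubgroup.subset_closure ⟨n, s, r • t, ?_⟩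
      rw [smul_sub, TensorProduct.smul_tmul', TensorProduct.smul_tmul', smul_comm s r t]
    | zero => rw [smul_zero]; exact zero_mem _
    | add x y _ _ hx hy => rw [smul_add]; exact add_mem hx hy
    | neg x _ hx => rw [smul_neg]; exact neg_mem hx

/-- The right `R`-module `N ⊗_S T`. -/
abbrev TensorObj (N : Type u) [AddCommGroup N] [Module Sᵐᵒᵖ N] : Type u :=
  (T ⊗[ℤ] N) ⧸ tensorKer S R T N

variable {N N' : Type u} [AddCommGroup N] [Module Sᵐᵒᵖ N] [AddCommGroup N'] [Module Sᵐᵒᵖ N']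

/-- The elementary tensor `n ⊗ t` in `N ⊗_S T`. -/
def tensorMk (n : N) (t : T) : TensorObj S R T N :=
  (tensorKer S R T N).mkQ (t ⊗ₜ[ℤ] n)

lemma tensorKer_le_comap (f : N →ₗ[Sᵐᵒᵖ] N') :
    tensorKer S R T N ≤ (tensorKer S R T N').comap
      (TensorProduct.AlgebraTensorModule.lTensor Rᵐᵒᵖ T f.toAddMonoidHom.toIntLinearMap) := by
  intro x hx
  change _ ∈ AddSubgroup.closure (tensorRel S T N')
  replace hx : x ∈ AddSubgroup.closure (tensorRel S T N) := hx
  induction hx using AddSubgroup.closure_induction with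
  | mem x hx =>
    obtain ⟨n, s, t, rfl⟩ := hx
    exact AddSubgroup.subset_closure ⟨f n, s, t, by simp⟩
  | zero => rw [map_zero]; exact zero_mem _
  | add x y _ _ hx hy => rw [map_add]; exact add_mem hx hy
  | neg x _ hx => rw [map_neg]; exact neg_mem hx

/-- The `R`-linear map `f ⊗_S T`. -/
def tensorMap (f : N →ₗ[Sᵐᵒᵖ] N') : TensorObj S R T N →ₗ[Rᵐᵒᵖ] TensorObj S R T N' :=
  (tensorKer S R T N).mapQ (tensorKer S R T N')
    (TensorProduct.AlgebraTensorModule.lTensor Rᵐᵒᵖ T f.toAddMonoidHom.toIntLinearMap)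
    (tensorKer_le_comap S R T f)

@[simp] lemma tensorMap_tensorMk (f : N →ₗ[Sᵐᵒᵖ] N') (n : N) (t : T) :
    tensorMap S R T f (tensorMk S R T n t) = tensorMk S R T (f n) t := rfl

variable {S R T} in
lemma tensorObj_hom_ext {X : Type u} [AddCommGroup X] [Module Rᵐᵒᵖ X]
    {g h : TensorObj S R T N →ₗ[Rᵐᵒᵖ] X}
    (H : ∀ n t, g (tensorMk S R T n t) = h (tensorMk S R T n t)) : g = h := by
  apply Submodule.linearMap_qext
  ext t n
  exact H n t

/-- The functor `- ⊗_S T : Mod-S ⥤ Mod-R`. -/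
def tensorFunctor : RightMod S ⥤ RightMod R where
  obj N := ModuleCat.of Rᵐᵒᵖ (TensorObj S R T N)
  map f := ModuleCat.ofHom (tensorMap S R T f.hom)
  map_id N := by
    ext1
    exact tensorObj_hom_ext fun n t => rfl
  map_comp f g := by
    ext1
    exact tensorObj_hom_ext fun n t => rfl

instance : (tensorFunctor S R T).Additive where
  map_add {N N'} f g := by
    ext1
    refine tensorObj_hom_ext fun n t => ?_
    change (tensorKer S R T N').mkQ (t ⊗ₜ[ℤ] (f.hom n + g.hom n)) =
      (tensorKer S R T N').mkQ (t ⊗ₜ[ℤ] f.hom n) + (tensorKer S R T N').mkQ (t ⊗ₜ[ℤ] g.hom n)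
    rw [TensorProduct.tmul_add, map_add]

/-- `Tor_i^S(N, T)`, as a right `R`-module: the value at `N` of the `i`-th left derived functor
of `- ⊗_S T`. -/
def Tor (i : ℕ) (N : RightMod S) : RightMod R :=
  ((tensorFunctor S R T).leftDerived i).obj N

/-- The class `𝓔` of the right `S`-modules `N` with `N ⊗_S T = 0` and `Tor_1^S(N, T) = 0`. -/
def classE : ObjectProperty (RightMod S) :=
  fun N => Subsingleton ((tensorFunctor S R T).obj N) ∧ Subsingleton (Tor S R T 1 N)

/-- The class `𝓜` of the right `S`-modules `M` with `Hom_S(N, M) = 0` and `Ext¹_S(N, M) = 0` for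
all `N` in `𝓔`. -/
def classM : ObjectProperty (RightMod S) := rightPerp (classE S R T)

/-- The class `Σ` of the morphisms `u` of right `S`-modules such that `u ⊗_S T` is invertible. -/
def sigma : MorphismProperty (RightMod S) :=
  (MorphismProperty.isomorphisms (RightMod R)).inverseImage (tensorFunctor S R T)

end Tensor

section Dual

variable (S R T W : Type u) [Ring S] [Ring R] [AddCommGroup T] [Module S T] [Module Rᵐᵒᵖ T]
  [SMulCommClass S Rᵐᵒᵖ T] [AddCommGroup W] [Module Rᵐᵒᵖ W]

/-- The dual `T^d = Hom_R(T, W)` of the `S`-`R`-bimodule `T`. -/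
def Dual (R T W : Type u) [Ring R] [AddCommGroup T] [Module Rᵐᵒᵖ T]
    [AddCommGroup W] [Module Rᵐᵒᵖ W] : Type u := T →ₗ[Rᵐᵒᵖ] W

instance : AddCommGroup (Dual R T W) := inferInstanceAs (AddCommGroup (T →ₗ[Rᵐᵒᵖ] W))

/-- The right `S`-module structure of `T^d`: `(f · s) t = f (s · t)`. -/
instance : Module Sᵐᵒᵖ (Dual R T W) where
  smul s f := LinearMap.comp (show T →ₗ[Rᵐᵒᵖ] W from f) (Module.toModuleEnd Rᵐᵒᵖ (S := S) T s.unop)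
  one_smul f := LinearMap.ext fun t => congrArg (show T →ₗ[Rᵐᵒᵖ] W from f) (one_smul S t)
  mul_smul a b f := LinearMap.ext fun t =>
    congrArg (show T →ₗ[Rᵐᵒᵖ] W from f) (mul_smul b.unop a.unop t)
  smul_zero _ := rfl
  smul_add _ _ _ := rfl
  add_smul a b f := LinearMap.ext fun t => by
    change (show T →ₗ[Rᵐᵒᵖ] W from f) ((a.unop + b.unop) • t) = _
    rw [add_smul, map_add]; rfl
  zero_smul f := LinearMap.ext fun t => by
    change (show T →ₗ[Rᵐᵒᵖ] W from f) ((0 : S) • t) = _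
    rw [zero_smul, map_zero]; rfl

/-- The class `𝓨 = 𝓕_{T^d} ∩ 𝓜`, where `𝓕_{T^d} = Cogen T^d`. -/
def classY : ObjectProperty (RightMod S) :=
  cogen Sᵐᵒᵖ (Dual R T W) ⊓ classM S R T

end Dual

/-- `W` is an injective cogenerator of `Mod-R`. -/
structure IsInjectiveCogenerator (R W : Type u) [Ring R] [AddCommGroup W] [Module Rᵐᵒᵖ W] :
    Prop where
  injective : Injective (ModuleCat.of Rᵐᵒᵖ W)
  cogenerator : IsCoseparator (ModuleCat.of Rᵐᵒᵖ W)

end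

end Tilting

open Tilting

/-! Write `w = f 1`, and let `i`, `q` exhibit `T₁` as a summand of `T`. Since `Ext¹(T₁, T) = 0`,
applying `Hom_R(-, T)` to `0 → R → T → T₁ → 0` gives a projective resolution `0 → S e → S → T → 0`
of the left `S`-module `T`, with `e = i q` idempotent, `e ↦ a = i g` and `1 ↦ w`. Hence `N ⊗_S T = N
/ N a`, and `Tor₁(N, T)` is the kernel of `N e → N`, `n e ↦ n a`; all later arguments use this
description.

The functor `- ⊗_S T` takes values in `Gen T`, and its right adjoint `Hom_R(T, -)` is fully faithful
on `Gen T` because the counit is invertible there (`IsOneTilting.isIso_counit_app`). A left adjoint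
of a fully faithful functor is a localization at the morphisms it inverts, with a calculus of left
fractions; this gives (1) and (2).

For (3), `Hom_R(T, -)` lands in `𝓨` (`homFunctor_obj_mem_cogen`, `homFunctor_obj_mem_classM`), and
the unit is invertible on `𝓨` (`isIso_unit_app`), so `𝓨` is the essential image of `Gen T`. -/

namespace CategoryTheory

/-! ### Vanishing of `Ext` and extension of morphisms -/

namespace Abelian.Ext

variable {C : Type*} [Category* C] [Abelian C] [HasExt.{u} C] {E : ShortComplex C}

lemma exists_extension_of_subsingleton (hE : E.ShortExact) {Y : C}
    [Subsingleton (Ext.{u} E.X₃ Y 1)] (φ : E.X₁ ⟶ Y) : ∃ ψ : E.X₂ ⟶ Y, E.f ≫ ψ = φ := by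
  obtain ⟨x, hx⟩ := contravariant_sequence_exact₁ hE Y (mk₀ φ) (add_zero 1)
    (Subsingleton.elim _ _)
  obtain ⟨ψ, rfl⟩ := (mk₀_bijective _ _).2 x
  exact ⟨ψ, (mk₀_bijective _ _).1 (by simpa using hx)⟩

lemma subsingleton_of_exists_extension (hE : E.ShortExact) [Projective E.X₂] {Y : C}
    (h : ∀ φ : E.X₁ ⟶ Y, ∃ ψ : E.X₂ ⟶ Y, E.f ≫ ψ = φ) :
    Subsingleton (Ext.{u} E.X₃ Y 1) := by
  refine subsingleton_of_forall_eq 0 fun x => ?_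
  obtain ⟨y, rfl⟩ := contravariant_sequence_exact₃ hE Y x (eq_zero_of_projective _) (add_zero 1)
  obtain ⟨φ, rfl⟩ := (mk₀_bijective _ _).2 y
  obtain ⟨ψ, rfl⟩ := h φ
  rw [← mk₀_comp_mk₀, hE.extClass_comp_assoc]

lemma subsingleton_of_retract {X X' Y : C} (r : Retract X' X) {n : ℕ}
    [Subsingleton (Ext.{u} X Y n)] : Subsingleton (Ext.{u} X' Y n) := by
  refine subsingleton_of_forall_eq 0 fun x => ?_
  have : x = (mk₀ r.i).comp ((mk₀ r.r).comp x (zero_add n)) (zero_add n) := by simp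
  rw [this, Subsingleton.elim ((mk₀ r.r).comp x (zero_add n)) 0, comp_zero]

/-- `Ext^{n+1}(X, -)` vanishes, so `Ext^n(X, -)` is right exact. -/
lemma subsingleton_of_hasProjectiveDimensionLE (hE : E.ShortExact) {X : C} {n : ℕ}
    [HasProjectiveDimensionLE X n] [Subsingleton (Ext.{u} X E.X₂ n)] :
    Subsingleton (Ext.{u} X E.X₃ n) := by
  refine subsingleton_of_forall_eq 0 fun x => ?_
  obtain ⟨y, rfl⟩ := covariant_sequence_exact₃ X hE x rfl
    (eq_zero_of_hasProjectiveDimensionLT _ (n + 1) le_rfl)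
  rw [Subsingleton.elim y 0, zero_comp]

end Abelian.Ext

end CategoryTheory

namespace Tilting

lemma shortExact_shortComplex {A L M N : Type u} [Ring A] [AddCommGroup L] [Module A L]
    [AddCommGroup M] [Module A M] [AddCommGroup N] [Module A N] {f : L →ₗ[A] M} {g : M →ₗ[A] N}
    (h : IsShortExact f g) :
    (ShortComplex.mk (ModuleCat.ofHom f) (ModuleCat.ofHom g)
      (by ext x; exact h.2.1.apply_apply_eq_zero x)).ShortExact :=
  ModuleCat.shortComplex_shortExact _ h.2.1 h.1 h.2.2

/-! ### `N ⊗_S T` and `Tor₁(N, T)` from a cyclic presentation of `T` -/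

section CyclicPresentation

variable {S R T : Type u} [Ring S] [Ring R] [AddCommGroup T] [Module S T] [Module Rᵐᵒᵖ T]
  [SMulCommClass S Rᵐᵒᵖ T]

/-- The data of a resolution `0 → S e → S → T → 0` of a left `S`-module `T`, in which `e` is
sent to `a` and `1` to `w`, such that moreover `e T` is contained in `a T`. -/
structure CyclicPresentation (S T : Type u) [Ring S] [AddCommGroup T] [Module S T] where
  /-- the generator of `T` -/
  w : T
  /-- the generator of the annihilator of `w` -/
  a : S
  /-- the element which generates the annihilator of `a` together with `1 - e` -/
  e : S
  exists_smul_eq : ∀ t : T, ∃ s : S, s • w = t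
  smul_w_eq_zero_iff : ∀ s : S, s • w = 0 ↔ ∃ s', s = s' * a
  e_mul_a : e * a = a
  mul_e_eq_zero : ∀ s : S, s * a = 0 → s * e = 0
  exists_a_smul_eq : ∀ t : T, ∃ t', a • t' = e • t

namespace CyclicPresentation

variable (p : CyclicPresentation S T)

lemma a_smul_w : p.a • p.w = 0 := (p.smul_w_eq_zero_iff _).2 ⟨1, by simp⟩

section Modules

variable (N : Type u) [AddCommGroup N] [Module Sᵐᵒᵖ N]

/-- The subgroup `N a` of the right `S`-module `N`. -/
def range : AddSubgroup N := (DistribSMul.toAddMonoidHom N (op p.a)).range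

variable {N}

lemma mem_range {n : N} : n ∈ p.range N ↔ ∃ n', op p.a • n' = n := Iff.rfl

/-- Two elements of `S` which agree on `w` act in the same way modulo `N a`. -/
lemma smul_sub_smul_mem_range (n : N) {s s' : S} (h : s • p.w = s' • p.w) :
    op s • n - op s' • n ∈ p.range N := by
  obtain ⟨x, hx⟩ := (p.smul_w_eq_zero_iff (s - s')).1 (by rw [sub_smul, h, sub_self])
  exact ⟨op x • n, by
    change op p.a • op x • n = _
    rw [← sub_smul, ← MulOpposite.op_sub, hx, op_mul, mul_smul]⟩

variable (N) in
/-- The map `N ⊗_ℤ T → N / N a` sending `n ⊗ s w` to the class of `n s`. -/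
noncomputable def evalTensor : T ⊗[ℤ] N →ₗ[ℤ] N ⧸ p.range N :=
  TensorProduct.lift <| AddMonoidHom.toIntLinearMap <|
    AddMonoidHom.mk' (fun t => AddMonoidHom.toIntLinearMap <|
      AddMonoidHom.mk' (fun n => QuotientAddGroup.mk (op (p.exists_smul_eq t).choose • n))
        (fun n n' => by rw [smul_add]; rfl))
    (fun t t' => by
      ext n
      change QuotientAddGroup.mk _ = QuotientAddGroup.mk (_ + _)
      rw [QuotientAddGroup.eq_iff_sub_mem, ← add_smul, ← MulOpposite.op_add]
      refine p.smul_sub_smul_mem_range n ?_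
      rw [add_smul, (p.exists_smul_eq _).choose_spec, (p.exists_smul_eq t).choose_spec,
        (p.exists_smul_eq t').choose_spec])

lemma evalTensor_smul_w (n : N) (s : S) :
    p.evalTensor N ((s • p.w) ⊗ₜ n) = QuotientAddGroup.mk (op s • n) := by
  change QuotientAddGroup.mk _ = QuotientAddGroup.mk _
  rw [QuotientAddGroup.eq_iff_sub_mem]
  exact p.smul_sub_smul_mem_range n (p.exists_smul_eq _).choose_spec

/-- Thus `evalTensor` descends to `N ⊗_S T`, where it inverts `N / N a → N ⊗_S T`, `n ↦ n ⊗ w`. -/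
lemma evalTensor_eq_zero_of_mem {x : T ⊗[ℤ] N} (hx : x ∈ tensorKer S R T N) :
    p.evalTensor N x = 0 := by
  replace hx : x ∈ AddSubgroup.closure (tensorRel S T N) := hx
  induction hx using AddSubgroup.closure_induction with
  | mem x hx =>
    obtain ⟨n, s, t, rfl⟩ := hx
    obtain ⟨s', rfl⟩ := p.exists_smul_eq t
    rw [map_sub, smul_smul, evalTensor_smul_w, evalTensor_smul_w, op_mul, mul_smul, sub_self]
  | zero => exact map_zero _
  | add x y _ _ hx hy => rw [map_add, hx, hy, add_zero]
  | neg x _ hx => rw [map_neg, hx, neg_zero]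

end Modules

end CyclicPresentation

section TensorMk

variable (S R T) {N : Type u} [AddCommGroup N] [Module Sᵐᵒᵖ N]

lemma tensorMk_add (n n' : N) (t : T) :
    tensorMk S R T (n + n') t = tensorMk S R T n t + tensorMk S R T n' t := by
  simp [tensorMk, TensorProduct.tmul_add]

lemma tensorMk_sub (n n' : N) (t : T) :
    tensorMk S R T (n - n') t = tensorMk S R T n t - tensorMk S R T n' t := by
  simp [tensorMk, TensorProduct.tmul_sub]

lemma tensorMk_add_right (n : N) (t t' : T) :
    tensorMk S R T n (t + t') = tensorMk S R T n t + tensorMk S R T n t' := by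
  simp [tensorMk, TensorProduct.add_tmul]

lemma tensorMk_zero_right (n : N) : tensorMk S R T n 0 = 0 := by
  simp [tensorMk]

lemma tensorMk_smul (n : N) (s : S) (t : T) :
    tensorMk S R T (op s • n) t = tensorMk S R T n (s • t) := by
  rw [tensorMk, tensorMk, ← sub_eq_zero, ← map_sub, Submodule.mkQ_apply,
    Submodule.Quotient.mk_eq_zero]
  exact AddSubgroup.subset_closure ⟨n, s, t, rfl⟩

end TensorMk

namespace CyclicPresentation

variable (p : CyclicPresentation S T) {N : Type u} [AddCommGroup N] [Module Sᵐᵒᵖ N]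

lemma exists_tensorMk_eq (x : TensorObj S R T N) : ∃ n, tensorMk S R T n p.w = x := by
  obtain ⟨x, rfl⟩ := Submodule.mkQ_surjective _ x
  induction x using TensorProduct.induction_on with
  | zero => exact ⟨0, by simp [tensorMk]⟩
  | tmul t n =>
    obtain ⟨s, rfl⟩ := p.exists_smul_eq t
    exact ⟨op s • n, tensorMk_smul S R T n s p.w⟩
  | add x y hx hy =>
    obtain ⟨n, hn⟩ := hx
    obtain ⟨n', hn'⟩ := hy
    exact ⟨n + n', by rw [tensorMk_add, hn, hn', map_add]⟩

variable (R) in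
lemma tensorMk_w_eq_zero_iff {n : N} :
    tensorMk S R T n p.w = 0 ↔ ∃ n', op p.a • n' = n := by
  constructor
  · intro h
    have h' := p.evalTensor_eq_zero_of_mem (R := R) ((Submodule.Quotient.mk_eq_zero _).1 h)
    rw [← one_smul S p.w, evalTensor_smul_w, QuotientAddGroup.eq_zero_iff] at h'
    simpa [mem_range] using h'
  · rintro ⟨n', rfl⟩
    rw [tensorMk_smul, a_smul_w, tensorMk_zero_right]

variable (R) in
lemma subsingleton_tensorObj_iff :
    Subsingleton (TensorObj S R T N) ↔ ∀ n : N, ∃ n', op p.a • n' = n := by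
  constructor
  · intro h n
    exact (p.tensorMk_w_eq_zero_iff R).1 (Subsingleton.elim _ _)
  · refine fun h => subsingleton_of_forall_eq 0 fun x => ?_
    obtain ⟨n, rfl⟩ := p.exists_tensorMk_eq x
    exact (p.tensorMk_w_eq_zero_iff R).2 (h n)

variable (N) in
/-- The vanishing of `Tor₁(N, T)`, computed from the resolution of `T`. -/
def TorFree : Prop := ∀ n : N, op p.a • n = 0 → op p.e • n = 0

lemma e_smul_a_smul (n : N) : op p.a • op p.e • n = op p.a • n := by
  rw [← mul_smul, ← op_mul, e_mul_a]

variable (N) in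
-- A projective module is a summand of a free one, where the condition holds coordinatewise by
-- `mul_e_eq_zero`.
lemma torFree_of_projective [Module.Projective Sᵐᵒᵖ N] : p.TorFree N := by
  intro n hn
  obtain ⟨σ, hσ⟩ := Module.projective_lifting_property
    (Finsupp.linearCombination Sᵐᵒᵖ (id : N → N)) LinearMap.id
    (fun n => ⟨Finsupp.single n 1, by simp⟩)
  have hσ' (n : N) : Finsupp.linearCombination Sᵐᵒᵖ (id : N → N) (σ n) = n :=
    DFunLike.congr_fun hσ n
  have h : op p.e • σ n = 0 := by
    have h0 : op p.a • σ n = 0 := by rw [← map_smul, hn, map_zero]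
    ext x
    have := p.mul_e_eq_zero (unop (σ n x)) (op_injective (by simpa using DFunLike.congr_fun h0 x))
    simpa using congrArg op this
  rw [← hσ' (op p.e • n), map_smul, h, map_zero]

variable (R) in
-- This is the balancing of `Tor`: the left side resolves `N`, the right side resolves `T`. Every
-- element of `P ⊗_S T` has the form `x ⊗ w`, so the comparison is a diagram chase on elements of
-- the resolution of `N`.
lemma subsingleton_tor_one_iff (N : RightMod S) :
    Subsingleton (Tor S R T 1 N) ↔ p.TorFree N := by
  let P := projectiveResolution N
  let F := tensorFunctor S R T
  have tor_iff : Subsingleton (Tor S R T 1 N) ↔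
      (((F.mapHomologicalComplex _).obj P.complex).sc' 2 1 0).Exact := by
    rw [← HomologicalComplex.exactAt_iff' _ 2 1 0 (by simp) (by simp),
      HomologicalComplex.exactAt_iff_isZero_homology, ← ModuleCat.isZero_iff_subsingleton]
    exact (P.isoLeftDerivedObj F 1).isZero_iff
  rw [tor_iff, ShortComplex.moduleCat_exact_iff]
  let d₂ := (P.complex.d 2 1).hom
  let d₁ := (P.complex.d 1 0).hom
  let π : P.complex.X 0 →ₗ[Sᵐᵒᵖ] N := (P.π.f 0).hom
  have exact₁ : ∀ x, d₁ x = 0 → ∃ y, d₂ y = x :=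
    (ShortComplex.moduleCat_exact_iff _).1 (P.exact_succ 0)
  have exact₀ : ∀ x, π x = 0 → ∃ y, d₁ y = x := (ShortComplex.moduleCat_exact_iff _).1 P.exact₀
  have π_d₁ (x) : π (d₁ x) = 0 := DFunLike.congr_fun
    (congrArg ModuleCat.Hom.hom P.complex_d_comp_π_f_zero) x
  have d₁_d₂ (x) : d₁ (d₂ x) = 0 := DFunLike.congr_fun
    (congrArg ModuleCat.Hom.hom (P.complex.d_comp_d 2 1 0)) x
  have π_surjective : Function.Surjective π :=
    (ModuleCat.epi_iff_surjective (P.π.f 0)).1 inferInstance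
  have projective : Module.Projective Sᵐᵒᵖ (P.complex.X 0) :=
    (IsProjective.iff_projective _).2 (P.projective 0)
  change (∀ x : TensorObj S R T (P.complex.X 1), tensorMap S R T d₁ x = 0 →
    ∃ y : TensorObj S R T (P.complex.X 2), tensorMap S R T d₂ y = x) ↔ _
  constructor
  · intro h n hn
    obtain ⟨x, rfl⟩ := π_surjective n
    obtain ⟨y, hy⟩ := exact₀ (op p.a • x) (by rw [map_smul, hn])
    obtain ⟨z, hz⟩ := h (tensorMk S R T y p.w) (by
      rw [tensorMap_tensorMk, hy, p.tensorMk_w_eq_zero_iff R]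
      exact ⟨x, rfl⟩)
    obtain ⟨z, rfl⟩ := p.exists_tensorMk_eq z
    rw [tensorMap_tensorMk, eq_comm, ← sub_eq_zero, ← tensorMk_sub,
      p.tensorMk_w_eq_zero_iff R] at hz
    obtain ⟨v, hv⟩ := hz
    -- From `y - d₂ z = v a` and `d₁ y = x a` one gets `(x - d₁ v) a = 0`; hence `x e = d₁ (v e)`,
    -- which `π` kills.
    have hx := p.torFree_of_projective (P.complex.X 0) (x - d₁ v) (by
      rw [smul_sub, ← map_smul, hv, map_sub, d₁_d₂, hy, sub_zero, sub_self])
    rw [smul_sub, sub_eq_zero] at hx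
    rw [← map_smul, hx, ← map_smul, π_d₁]
  · intro h x hx
    obtain ⟨x, rfl⟩ := p.exists_tensorMk_eq x
    rw [tensorMap_tensorMk, p.tensorMk_w_eq_zero_iff R] at hx
    obtain ⟨y, hy⟩ := hx
    obtain ⟨v, hv⟩ := exact₀ (op p.e • y) (by
      rw [map_smul]
      exact h _ (by rw [← map_smul, hy, π_d₁]))
    -- Subtracting `v a` does not change the class `x ⊗ w`, and it makes `x` a cycle.
    obtain ⟨z, hz⟩ := exact₁ (x - op p.a • v) (by
      rw [map_sub, map_smul, hv, p.e_smul_a_smul, hy, sub_self])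
    refine ⟨tensorMk S R T z p.w, ?_⟩
    rw [tensorMap_tensorMk, hz, eq_comm, ← sub_eq_zero, ← tensorMk_sub, sub_sub_cancel,
      p.tensorMk_w_eq_zero_iff R]
    exact ⟨v, rfl⟩

end CyclicPresentation

end CyclicPresentation

/-! ### The adjunction between `- ⊗_S T` and `Hom_R(T, -)` -/

section HomFunctor

variable (S R T : Type u) [Ring S] [Ring R] [AddCommGroup T] [Module S T] [Module Rᵐᵒᵖ T]
  [SMulCommClass S Rᵐᵒᵖ T]

instance (M : Type u) [AddCommGroup M] [Module Rᵐᵒᵖ M] : FunLike (Dual R T M) T M :=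
  inferInstanceAs (FunLike (T →ₗ[Rᵐᵒᵖ] M) T M)

instance (M : Type u) [AddCommGroup M] [Module Rᵐᵒᵖ M] :
    LinearMapClass (Dual R T M) Rᵐᵒᵖ T M :=
  inferInstanceAs (LinearMapClass (T →ₗ[Rᵐᵒᵖ] M) Rᵐᵒᵖ T M)

/-- Postcomposition with `f`, as an `S`-linear map. -/
def dualMap {M M' : Type u} [AddCommGroup M] [Module Rᵐᵒᵖ M] [AddCommGroup M'] [Module Rᵐᵒᵖ M']
    (f : M →ₗ[Rᵐᵒᵖ] M') : Dual R T M →ₗ[Sᵐᵒᵖ] Dual R T M' where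
  toFun h := f ∘ₗ (show T →ₗ[Rᵐᵒᵖ] M from h)
  map_add' h h' := LinearMap.ext fun t => map_add f (h t) (h' t)
  map_smul' _ _ := rfl

/-- The functor `Hom_R(T, -) : Mod-R ⥤ Mod-S`. -/
def homFunctor : RightMod R ⥤ RightMod S where
  obj M := ModuleCat.of Sᵐᵒᵖ (Dual R T M)
  map f := ModuleCat.ofHom (dualMap S R T f.hom)

variable (N M : Type u) [AddCommGroup N] [Module Sᵐᵒᵖ N] [AddCommGroup M] [Module Rᵐᵒᵖ M]

variable {N} in
/-- The map `t ↦ n ⊗ t`. -/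
def tensorMkLinearMap (n : N) : T →ₗ[Rᵐᵒᵖ] TensorObj S R T N where
  toFun := tensorMk S R T n
  map_add' := tensorMk_add_right S R T n
  map_smul' _ _ := rfl

variable {N M} in
/-- The map `N ⊗_S T → M` which corresponds to a map `N → Hom_R(T, M)`. -/
noncomputable def uncurry (h : N →ₗ[Sᵐᵒᵖ] Dual R T M) : TensorObj S R T N →ₗ[Rᵐᵒᵖ] M :=
  (tensorKer S R T N).liftQ
    (TensorProduct.AlgebraTensorModule.lift
      { toFun := fun t => AddMonoidHom.toIntLinearMap
          (AddMonoidHom.mk' (fun n => h n t) fun n n' => by rw [map_add]; rfl)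
        map_add' := fun t t' => by ext n; exact map_add (h n) t t'
        map_smul' := fun r t => by ext n; exact map_smul (h n) r t })
    (by
      intro x hx
      replace hx : x ∈ AddSubgroup.closure (tensorRel S T N) := hx
      rw [LinearMap.mem_ker]
      induction hx using AddSubgroup.closure_induction with
      | mem x hx =>
        obtain ⟨n, s, t, rfl⟩ := hx
        rw [map_sub, sub_eq_zero]
        change h (op s • n) t = h n (s • t)
        rw [map_smul]; rfl
      | zero => exact map_zero _
      | add x y _ _ hx hy => rw [map_add, hx, hy, add_zero]
      | neg x _ hx => rw [map_neg, hx, neg_zero])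

/-- The adjunction between tensor product and `Hom` on the level of `Hom`-sets. -/
noncomputable def curryEquiv :
    (TensorObj S R T N →ₗ[Rᵐᵒᵖ] M) ≃ (N →ₗ[Sᵐᵒᵖ] Dual R T M) where
  toFun g :=
    { toFun := fun n => g ∘ₗ tensorMkLinearMap S R T n
      map_add' := fun n n' => LinearMap.ext fun t =>
        (congrArg g (tensorMk_add S R T n n' t)).trans (map_add g _ _)
      map_smul' := fun s n => LinearMap.ext fun t =>
        congrArg g (tensorMk_smul S R T n (unop s) t) }
  invFun := uncurry S R T
  left_inv _ := tensorObj_hom_ext fun _ _ => rfl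
  right_inv _ := rfl

/-- The functor `- ⊗_S T` is left adjoint to `Hom_R(T, -)`. -/
noncomputable def tensorHomAdjunction : tensorFunctor S R T ⊣ homFunctor S R T :=
  Adjunction.mkOfHomEquiv
    { homEquiv := fun N M => (ModuleCat.homEquiv.trans (curryEquiv S R T N M)).trans
        ModuleCat.homEquiv.symm
      homEquiv_naturality_left_symm := fun f g => by
        ext1
        exact tensorObj_hom_ext fun n t => rfl
      homEquiv_naturality_right := fun f g => rfl }

end HomFunctor

/-! ### The class `𝓨` and the unit of the adjunction -/

section Perpendicular

variable {S R T W : Type u} [Ring S] [Ring R] [AddCommGroup T] [Module S T] [Module Rᵐᵒᵖ T]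
  [SMulCommClass S Rᵐᵒᵖ T] [AddCommGroup W] [Module Rᵐᵒᵖ W]

lemma IsInjectiveCogenerator.exists_apply_ne_zero (hW : IsInjectiveCogenerator R W)
    {M : Type u} [AddCommGroup M] [Module Rᵐᵒᵖ M] {m : M} (hm : m ≠ 0) :
    ∃ φ : M →ₗ[Rᵐᵒᵖ] W, φ m ≠ 0 := by
  by_contra! h
  refine hm ?_
  have := (isCoseparator_def _).1 hW.cogenerator
    (ModuleCat.ofHom (LinearMap.toSpanSingleton Rᵐᵒᵖ M m)) 0 (fun φ => by
      ext
      simpa using h φ.hom)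
  simpa using DFunLike.congr_fun (congrArg ModuleCat.Hom.hom this) (1 : Rᵐᵒᵖ)

/-- The index set consists of all maps `M → W`; they separate the points of `M`. -/
lemma homFunctor_obj_mem_cogen (hW : IsInjectiveCogenerator R W) (M : RightMod R) :
    cogen Sᵐᵒᵖ (Dual R T W) ((homFunctor S R T).obj M) := by
  refine ⟨M →ₗ[Rᵐᵒᵖ] W, LinearMap.pi fun φ => dualMap S R T φ, ?_⟩
  rw [← LinearMap.ker_eq_bot, LinearMap.ker_eq_bot']
  intro (h : Dual R T M) hh
  refine LinearMap.ext fun t => ?_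
  by_contra ht
  obtain ⟨φ, hφ⟩ := hW.exists_apply_ne_zero ht
  exact hφ (DFunLike.congr_fun (F := Dual R T W) (congrFun hh φ) t)

/-- Each coordinate `N → T^d` of an embedding corresponds to a map `N ⊗_S T → W`, so it kills every
`n` with `n ⊗ t = 0` for all `t`. -/
lemma injective_unit_of_mem_cogen {N : RightMod S} (hN : cogen Sᵐᵒᵖ (Dual R T W) N) :
    Function.Injective ((tensorHomAdjunction S R T).unit.app N).hom := by
  obtain ⟨ι, f, hf⟩ := hN
  refine (injective_iff_map_eq_zero _).2 fun n hn => hf ?_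
  rw [map_zero]
  funext i
  refine LinearMap.ext fun t => ?_
  have h : tensorMk S R T n t = 0 := DFunLike.congr_fun (F := Dual R T (TensorObj S R T N)) hn t
  exact (congrArg (uncurry S R T (LinearMap.proj i ∘ₗ f)) h).trans (map_zero _)

namespace CyclicPresentation

variable (R) in
lemma classE_iff (p : CyclicPresentation S T) (N : RightMod S) :
    classE S R T N ↔ (∀ n : N, ∃ n', op p.a • n' = n) ∧ p.TorFree N :=
  and_congr (p.subsingleton_tensorObj_iff R) (p.subsingleton_tor_one_iff R N)

/-- A map that vanishes on `a T` vanishes on `e T`, which is contained in it. -/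
lemma torFree_dual (p : CyclicPresentation S T) (M : Type u) [AddCommGroup M]
    [Module Rᵐᵒᵖ M] : p.TorFree (Dual R T M) := by
  intro h hh
  refine LinearMap.ext fun t => ?_
  obtain ⟨t', ht'⟩ := p.exists_a_smul_eq t
  change h (p.e • t) = 0
  rw [← ht']
  exact DFunLike.congr_fun hh t'

lemma homFunctor_obj_mem_classM (p : CyclicPresentation S T) (M : RightMod R) :
    classM S R T ((homFunctor S R T).obj M) := by
  intro N hN
  constructor
  · intro f
    apply ((tensorHomAdjunction S R T).homEquiv N M).symm.injective
    have := hN.1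
    exact (ModuleCat.isZero_of_subsingleton _).eq_of_src _ _
  · rw [p.classE_iff R] at hN
    obtain ⟨P⟩ := EnoughProjectives.presentation N
    have hf : Function.Surjective P.f.hom := (ModuleCat.epi_iff_surjective _).1 P.epi
    have projective : Module.Projective Sᵐᵒᵖ P.p := (IsProjective.iff_projective _).2 P.projective
    let K := LinearMap.ker P.f.hom
    have hE : IsShortExact K.subtype P.f.hom :=
      ⟨K.injective_subtype, LinearMap.exact_subtype_ker_map _, hf⟩
    have := P.projective
    -- Injectivity comes from `Tor₁(N, T) = 0`, surjectivity from `N ⊗_S T = 0`. By adjunction, maps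
    -- `K → Hom_R(T, M)` then extend to the projective `P.p`.
    have iso : IsIso ((tensorFunctor S R T).map (ModuleCat.ofHom K.subtype)) := by
      rw [ConcreteCategory.isIso_iff_bijective]
      constructor
      · refine (injective_iff_map_eq_zero _).2 fun (x : TensorObj S R T K) hx => ?_
        obtain ⟨⟨x, hxK⟩, rfl⟩ := p.exists_tensorMk_eq x
        obtain ⟨y, rfl⟩ := (p.tensorMk_w_eq_zero_iff R).1 hx
        rw [LinearMap.mem_ker, map_smul] at hxK
        refine (p.tensorMk_w_eq_zero_iff R).2 ⟨⟨op p.e • y, ?_⟩, Subtype.ext (p.e_smul_a_smul y)⟩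
        rw [LinearMap.mem_ker, map_smul]
        exact hN.2 _ hxK
      · intro (x : TensorObj S R T P.p)
        obtain ⟨x, rfl⟩ := p.exists_tensorMk_eq x
        obtain ⟨n, hn⟩ := hN.1 (P.f.hom x)
        obtain ⟨y, rfl⟩ := hf n
        refine ⟨tensorMk S R T (⟨x - op p.a • y, ?_⟩ : K) p.w, ?_⟩
        · rw [LinearMap.mem_ker, map_sub, map_smul, hn, sub_self]
        · change tensorMk S R T (x - op p.a • y) p.w = _
          rw [tensorMk_sub, (p.tensorMk_w_eq_zero_iff R).2 ⟨y, rfl⟩, sub_zero]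
    refine Abelian.Ext.subsingleton_of_exists_extension (shortExact_shortComplex hE) fun φ => ?_
    let adj := tensorHomAdjunction S R T
    refine ⟨adj.homEquiv _ _ (inv ((tensorFunctor S R T).map (ModuleCat.ofHom K.subtype)) ≫
      (adj.homEquiv _ _).symm φ), ?_⟩
    erw [← adj.homEquiv_naturality_left]
    rw [IsIso.hom_inv_id_assoc, Equiv.apply_symm_apply]

/-- A module in `𝓜` with injective unit `N → Hom_R(T, N ⊗_S T)` is reflexive, provided that the
counit at `N ⊗_S T` is invertible. -/
lemma isIso_unit_app (p : CyclicPresentation S T) {N : RightMod S} (hN : classM S R T N)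
    (hinj : Function.Injective ((tensorHomAdjunction S R T).unit.app N).hom)
    [IsIso ((tensorHomAdjunction S R T).counit.app ((tensorFunctor S R T).obj N))] :
    IsIso ((tensorHomAdjunction S R T).unit.app N) := by
  let adj := tensorHomAdjunction S R T
  let Q := (homFunctor S R T).obj ((tensorFunctor S R T).obj N)
  let η : N →ₗ[Sᵐᵒᵖ] Q := (adj.unit.app N).hom
  have iso : IsIso ((tensorFunctor S R T).map (adj.unit.app N)) := by
    have := adj.left_triangle_components N
    rw [← IsIso.eq_comp_inv] at this
    rw [this]
    infer_instance
  have bij : Function.Bijective (tensorMap S R T η) :=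
    (ConcreteCategory.isIso_iff_bijective _).1 iso
  have hE : IsShortExact η η.range.mkQ :=
    ⟨hinj, LinearMap.exact_map_mkQ_range η, Submodule.mkQ_surjective _⟩
  -- The cokernel of the unit lies in `𝓔`, since `η ⊗_S T` is bijective and `Tor₁(Q, T) = 0`.
  have hC : classE S R T (ModuleCat.of Sᵐᵒᵖ (Q ⧸ η.range)) := by
    rw [p.classE_iff R]
    constructor
    · intro c
      obtain ⟨x, rfl⟩ := Submodule.mkQ_surjective _ c
      obtain ⟨y, hy⟩ := bij.2 (tensorMk S R T x p.w)
      obtain ⟨n, rfl⟩ := p.exists_tensorMk_eq y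
      rw [tensorMap_tensorMk, eq_comm, ← sub_eq_zero, ← tensorMk_sub,
        p.tensorMk_w_eq_zero_iff R] at hy
      obtain ⟨z, hz⟩ := hy
      refine ⟨η.range.mkQ z, ?_⟩
      rw [← map_smul, hz, map_sub, hE.2.1.apply_apply_eq_zero, sub_zero]
    · intro c hc
      obtain ⟨x, rfl⟩ := Submodule.mkQ_surjective _ c
      rw [← map_smul] at hc
      obtain ⟨n, hn⟩ := (hE.2.1 _).1 hc
      have h0 : tensorMk S R T n p.w = 0 := bij.1 (by
        rw [tensorMap_tensorMk, hn, map_zero, p.tensorMk_w_eq_zero_iff R]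
        exact ⟨x, rfl⟩)
      obtain ⟨n', rfl⟩ := (p.tensorMk_w_eq_zero_iff R).1 h0
      have torFree : p.TorFree Q := p.torFree_dual (TensorObj S R T N)
      have hx := torFree (x - η n') (by
        rw [smul_sub, ← map_smul, hn, sub_self])
      rw [smul_sub, sub_eq_zero] at hx
      rw [← map_smul, hx, ← map_smul, hE.2.1.apply_apply_eq_zero]
  have := (hN _ hC).2
  obtain ⟨r, hr⟩ := Abelian.Ext.exists_extension_of_subsingleton (shortExact_shortComplex hE) (𝟙 N)
  replace hr : adj.unit.app N ≫ r = 𝟙 N := hr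
  refine ⟨r, hr, ?_⟩
  let ρ : Q →ₗ[Sᵐᵒᵖ] N := r.hom
  have hρ (n : N) : ρ (η n) = n := DFunLike.congr_fun (congrArg ModuleCat.Hom.hom hr) n
  -- The unit splits; the complementary projection factors through the cokernel, and `Hom(𝓔, Q) = 0`
  -- kills it.
  let δ : Q ⧸ η.range →ₗ[Sᵐᵒᵖ] Q := η.range.liftQ (LinearMap.id - η ∘ₗ ρ) (by
    rintro _ ⟨n, rfl⟩
    rw [LinearMap.mem_ker, LinearMap.sub_apply, LinearMap.comp_apply, hρ, LinearMap.id_apply,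
      sub_self])
  have hδ := (p.homFunctor_obj_mem_classM ((tensorFunctor S R T).obj N) _ hC).1
    (ModuleCat.ofHom δ)
  ext1
  refine LinearMap.ext fun x => ?_
  have hx : (show Q from x) - η (ρ x) = 0 :=
    DFunLike.congr_fun (congrArg ModuleCat.Hom.hom hδ) (η.range.mkQ x)
  exact (sub_eq_zero.1 hx).symm

end CyclicPresentation

end Perpendicular

/-! ### Consequences of the tilting hypotheses -/

section Tilting

variable {R T : Type u} [Ring R] [AddCommGroup T] [Module Rᵐᵒᵖ T]

lemma IsOneTilting.subsingleton_ext_one (hT : IsOneTilting R T) {M : RightMod R}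
    (hM : gen Rᵐᵒᵖ T M) : Subsingleton (Abelian.Ext.{u} (ModuleCat.of Rᵐᵒᵖ T) M 1) := by
  obtain ⟨ι, f, hf⟩ := hM
  have := hT.projDim_le_one
  have := hT.ext_eq_zero ι 1 le_rfl
  have hE : IsShortExact (LinearMap.ker f).subtype f :=
    ⟨Submodule.injective_subtype _, LinearMap.exact_subtype_ker_map _, hf⟩
  exact Abelian.Ext.subsingleton_of_hasProjectiveDimensionLE (shortExact_shortComplex hE)

/-- Elements of a module `M` in `Gen T` are values at `f 1` of maps `T → M`. -/
lemma IsOneTilting.exists_apply_eq (hT : IsOneTilting R T) {T₁ : RightMod R}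
    {f : R →ₗ[Rᵐᵒᵖ] T} {g : T →ₗ[Rᵐᵒᵖ] T₁} (hT₁ : IsDirectSummand Rᵐᵒᵖ T₁ T)
    (hfg : IsShortExact f g) {M : RightMod R} (hM : gen Rᵐᵒᵖ T M) (m : M) :
    ∃ h : T →ₗ[Rᵐᵒᵖ] M, h (f 1) = m := by
  obtain ⟨i, q, hqi⟩ := hT₁
  have := hT.subsingleton_ext_one hM
  have : Subsingleton (Abelian.Ext.{u} (ModuleCat.of Rᵐᵒᵖ T₁) M 1) :=
    Abelian.Ext.subsingleton_of_retract (X := ModuleCat.of Rᵐᵒᵖ T)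
      { i := ModuleCat.ofHom i, r := ModuleCat.ofHom q, retract := ModuleCat.hom_ext hqi }
  let φ : R →ₗ[Rᵐᵒᵖ] M :=
    { toFun := fun r => op r • m
      map_add' := fun r r' => by rw [MulOpposite.op_add, add_smul]
      map_smul' := fun r r' => by
        rw [RingHom.id_apply, ← mul_smul]; rfl }
  obtain ⟨ψ, hψ⟩ := Abelian.Ext.exists_extension_of_subsingleton (shortExact_shortComplex hfg)
    (ModuleCat.ofHom φ)
  exact ⟨ψ.hom, (DFunLike.congr_fun (congrArg ModuleCat.Hom.hom hψ) (1 : R)).trans (one_smul _ m)⟩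

/-- Maps out of `T` which vanish at `f 1` factor through `g`. -/
lemma exists_comp_eq_of_apply_one_eq_zero {T₁ : RightMod R}
    {f : R →ₗ[Rᵐᵒᵖ] T} {g : T →ₗ[Rᵐᵒᵖ] T₁} (hfg : IsShortExact f g)
    {M : Type u} [AddCommGroup M] [Module Rᵐᵒᵖ M] {h : T →ₗ[Rᵐᵒᵖ] M} (hh : h (f 1) = 0) :
    ∃ k : T₁ →ₗ[Rᵐᵒᵖ] M, k ∘ₗ g = h := by
  have hker : LinearMap.ker g ≤ LinearMap.ker h := by
    intro t ht
    obtain ⟨r, rfl⟩ := (hfg.2.1 t).1 ht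
    have hr : r = op r • (1 : R) := (one_mul r).symm
    rw [LinearMap.mem_ker, hr, map_smul, map_smul, hh, smul_zero]
  refine ⟨(LinearMap.ker g).liftQ h hker ∘ₗ (g.quotKerEquivOfSurjective hfg.2.2).symm, ?_⟩
  ext t
  have : (g.quotKerEquivOfSurjective hfg.2.2).symm (g t) = (LinearMap.ker g).mkQ t := by
    rw [LinearEquiv.symm_apply_eq]; rfl
  simp [this]

lemma gen_self : gen Rᵐᵒᵖ T (ModuleCat.of Rᵐᵒᵖ T) :=
  ⟨PUnit, Finsupp.lapply PUnit.unit, fun t => ⟨Finsupp.single PUnit.unit t, by simp⟩⟩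

/-- The presentation of the left `End_R(T)`-module `T` which is obtained by applying `Hom_R(-, T)`
to the short exact sequence `0 → R → T → T₁ → 0`. -/
def IsOneTilting.cyclicPresentation (hT : IsOneTilting R T) {T₁ : RightMod R}
    {f : R →ₗ[Rᵐᵒᵖ] T} {g : T →ₗ[Rᵐᵒᵖ] T₁} {i : T₁ →ₗ[Rᵐᵒᵖ] T} {q : T →ₗ[Rᵐᵒᵖ] T₁}
    (hqi : q ∘ₗ i = LinearMap.id) (hfg : IsShortExact f g) :
    CyclicPresentation (EndRing R T) T where
  w := f 1
  a := i ∘ₗ g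
  e := i ∘ₗ q
  exists_smul_eq t := hT.exists_apply_eq ⟨i, q, hqi⟩ hfg gen_self t
  smul_w_eq_zero_iff s := by
    constructor
    · intro hs
      obtain ⟨k, rfl⟩ := exists_comp_eq_of_apply_one_eq_zero hfg hs
      -- Since `q i = 1`, one has `k g = (k q)(i g) = (k q) a`.
      exact ⟨k ∘ₗ q, LinearMap.ext fun t => congrArg k (DFunLike.congr_fun hqi (g t)).symm⟩
    · rintro ⟨s', rfl⟩
      change s' (i (g (f 1))) = 0
      rw [hfg.2.1.apply_apply_eq_zero, map_zero, map_zero]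
  e_mul_a := LinearMap.ext fun t => congrArg i (DFunLike.congr_fun hqi (g t))
  mul_e_eq_zero s hs := LinearMap.ext fun t => by
    obtain ⟨t', ht'⟩ := hfg.2.2 (q t)
    change s (i (q t)) = 0
    rw [← ht']
    exact DFunLike.congr_fun hs t'
  exists_a_smul_eq t := (hfg.2.2 (q t)).imp fun _ h => congrArg i h

lemma CyclicPresentation.tensorObj_mem_gen {S : Type u} [Ring S] [Module S T]
    [SMulCommClass S Rᵐᵒᵖ T] (p : CyclicPresentation S T) (N : RightMod S) :
    gen Rᵐᵒᵖ T ((tensorFunctor S R T).obj N) := by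
  refine ⟨N, Finsupp.lsum ℕ (tensorMkLinearMap S R T), fun x => ?_⟩
  obtain ⟨n, rfl⟩ := p.exists_tensorMk_eq x
  exact ⟨Finsupp.single n p.w, (Finsupp.lsum_single ℕ _ _ _).trans rfl⟩

/-- The counit sends `h ⊗ w` to `h w`. If `h w = 0`, then `h = k g = (k q) a` lies in `Hom_R(T, M)
a`, so `h ⊗ w = 0`; surjectivity is `exists_apply_eq`. -/
lemma IsOneTilting.isIso_counit_app (hT : IsOneTilting R T) {T₁ : RightMod R}
    {f : R →ₗ[Rᵐᵒᵖ] T} {g : T →ₗ[Rᵐᵒᵖ] T₁} {i : T₁ →ₗ[Rᵐᵒᵖ] T} {q : T →ₗ[Rᵐᵒᵖ] T₁}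
    (hqi : q ∘ₗ i = LinearMap.id) (hfg : IsShortExact f g) {M : RightMod R}
    (hM : gen Rᵐᵒᵖ T M) :
    IsIso ((tensorHomAdjunction (EndRing R T) R T).counit.app M) := by
  let p := hT.cyclicPresentation hqi hfg
  rw [ConcreteCategory.isIso_iff_bijective]
  constructor
  · refine (injective_iff_map_eq_zero _).2 fun (x : TensorObj (EndRing R T) R T _) hx => ?_
    obtain ⟨h, rfl⟩ := p.exists_tensorMk_eq x
    obtain ⟨k, hk⟩ := exists_comp_eq_of_apply_one_eq_zero hfg (h := (h : Dual R T M)) hx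
    refine (p.tensorMk_w_eq_zero_iff R).2 ⟨(k ∘ₗ q : T →ₗ[Rᵐᵒᵖ] M), ?_⟩
    rw [← hk]
    exact LinearMap.ext fun t => congrArg k (DFunLike.congr_fun hqi (g t))
  · intro m
    obtain ⟨h, rfl⟩ := hT.exists_apply_eq ⟨i, q, hqi⟩ hfg hM m
    exact ⟨tensorMk (EndRing R T) R T (show Dual R T M from h) (f 1), rfl⟩

end Tilting

end Tilting

theorem propositionP (R T W : Type u) [Ring R] [AddCommGroup T] [Module Rᵐᵒᵖ T]
    [AddCommGroup W] [Module Rᵐᵒᵖ W]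
    (hT : IsOneTilting R T) (hseq : HasSpecialSequence R T)
    (hW : IsInjectiveCogenerator R W) :
    -- `Σ` admits a calculus of left fractions
    (sigma (EndRing R T) R T).HasLeftCalculusOfFractions ∧
    -- the functor `- ⊗_S T` is the composite of the localization functor with an equivalence
    -- from `Mod-S[Σ⁻¹]` onto the full subcategory `Gen T` of `Mod-R`
    (∃ ρ : (sigma (EndRing R T) R T).Localization ⥤ (gen Rᵐᵒᵖ T).FullSubcategory,
      ρ.IsEquivalence ∧
      (sigma (EndRing R T) R T).Q ⋙ ρ ⋙ (gen Rᵐᵒᵖ T).ι = tensorFunctor (EndRing R T) R T) ∧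
    -- `Mod-S[Σ⁻¹]` is equivalent to `𝓨`
    Nonempty ((sigma (EndRing R T) R T).Localization ≌
      (classY (EndRing R T) R T W).FullSubcategory) := by
  obtain ⟨T₁, f, g, ⟨i, q, hqi⟩, hfg⟩ := hseq
  let S := EndRing R T
  let p := hT.cyclicPresentation hqi hfg
  let adj := tensorHomAdjunction S R T
  let F := (gen Rᵐᵒᵖ T).lift (tensorFunctor S R T) p.tensorObj_mem_gen
  let G := (gen Rᵐᵒᵖ T).ι ⋙ homFunctor S R T
  have counit_isIso (M : (gen Rᵐᵒᵖ T).FullSubcategory) : IsIso (adj.counit.app M.obj) :=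
    hT.isIso_counit_app hqi hfg M.property
  let adj' : F ⊣ G := adj.restrictFullyFaithful (Functor.FullyFaithful.id _)
    (gen Rᵐᵒᵖ T).fullyFaithfulι (Iso.refl _) (Iso.refl _)
  have (M : (gen Rᵐᵒᵖ T).FullSubcategory) : IsIso (adj'.counit.app M) := by
    have : IsIso ((gen Rᵐᵒᵖ T).ι.map (adj'.counit.app M)) := by
      rw [Adjunction.map_restrictFullyFaithful_counit_app]
      have := counit_isIso M
      dsimp
      infer_instance
    exact isIso_of_fully_faithful (gen Rᵐᵒᵖ T).ι _
  have : IsIso adj'.counit := NatIso.isIso_of_isIso_app _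
  let hG := adj'.fullyFaithfulROfIsIsoCounit
  have := hG.full
  have := hG.faithful
  have sigma_eq : sigma S R T = (MorphismProperty.isomorphisms _).inverseImage F := by
    ext N N' u
    exact (isIso_iff_of_reflects_iso (F.map u) (gen Rᵐᵒᵖ T).ι)
  have loc : F.IsLocalization (sigma S R T) := by
    rw [sigma_eq]
    exact adj'.isLocalization
  -- The strict lift from the explicit construction yields an equality of functors, not only an
  -- isomorphism.
  let ρ := Localization.Construction.lift F loc.inverts
  have ρ_equiv : ρ.IsEquivalence := loc.isEquivalence
  refine ⟨by rw [sigma_eq]; exact adj'.hasLeftCalculusOfFractions', ⟨ρ, ρ_equiv, ?_⟩, ⟨?_⟩⟩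
  · rw [← Functor.assoc, Localization.Construction.fac]
    rfl
  · let H := (classY S R T W).lift G fun M =>
      ⟨homFunctor_obj_mem_cogen hW M.obj, p.homFunctor_obj_mem_classM M.obj⟩
    have : H.EssSurj := ⟨fun Y => by
      have := counit_isIso ⟨_, p.tensorObj_mem_gen Y.obj⟩
      have := p.isIso_unit_app Y.property.2 (injective_unit_of_mem_cogen Y.property.1)
      exact ⟨F.obj Y.obj, ⟨(classY S R T W).isoMk (asIso (adj.unit.app Y.obj)).symm⟩⟩⟩
    have : (H ⋙ (classY S R T W).ι).Full := hG.full
    have : (H ⋙ (classY S R T W).ι).Faithful := hG.faithful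
    have : H.Faithful := Functor.Faithful.of_comp H (classY S R T W).ι
    have : H.Full := Functor.Full.of_comp_faithful H (classY S R T W).ι
    have : H.IsEquivalence := { }
    exact ρ.asEquivalence.trans H.asEquivalence
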